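/- Let $n_1,n_2,m\ge 0$ and $1\le r\le \min(n_1,n_2)$ be integers, put $n=\max(n_1,n_2)$, and let $\mathcal{A}:\mathbb{R}^{n_1\times n_2}\to\mathbb{R}^m$ be a linear map. Let $\delta_r$ be the isometry constant of $\mathcal{A}$ at rank $r$, i.e. the smallest real number such that $$(1-\delta_r)\|X\|_F^2\le\|\mathcal{A}(X)\|_{\ell_2}^2\le(1+\delta_r)\|X\|_F^2$$ for all $X\in\mathbb{R}^{n_1\times n_2}$ of rank at most $r$, where $\|\cdot\|_F$ is the Frobenius norm. Let $\sigma\ge 0$ and let $z$ be a random vector in $\mathbb{R}^m$ with i.i.d. $\mathcal{N}(0,\sigma^2)$ entries. For $M \in \mathbb{R}^{n_1\times n_2}$ consider the data $y=\mathcal{A}(M)+z$. Then every estimator, i.e. every measurable map $\hat M:\mathbb{R}^m\to\mathbb{R}^{n_1\times n_2}$, satisfies $$\sup_{M\in\mathbb{R}^{n_1\times n_2}:\ \operatorname{rank}(M)\le r}\mathbb{E}\,\|\hat M(y)-M\|_F^2\ \ge\ \frac{1}{1+\delta_r}\,n\,r\,\sigma^2,$$ where the expectations and the supremum take values in $[0,\infty]$.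 -/

import Mathlib

open MeasureTheory ProbabilityTheory
open scoped NNReal ENNReal

/- The norm of a matrix is its Frobenius norm throughout. -/
attribute [local instance] Matrix.frobeniusNormedAddCommGroup Matrix.frobeniusNormedSpace

/-- The set of all `δ` for which
`(1 - δ) ‖X‖_F² ≤ ‖A X‖² ≤ (1 + δ) ‖X‖_F²` holds for every matrix `X` of rank at most `r`. -/
def isometryBounds {n₁ n₂ m : ℕ}
    (A : Matrix (Fin n₁) (Fin n₂) ℝ →ₗ[ℝ] EuclideanSpace ℝ (Fin m)) (r : ℕ) : Set ℝ :=
  {δ | ∀ X : Matrix (Fin n₁) (Fin n₂) ℝ, X.rank ≤ r →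
    (1 - δ) * ‖X‖ ^ 2 ≤ ‖A X‖ ^ 2 ∧ ‖A X‖ ^ 2 ≤ (1 + δ) * ‖X‖ ^ 2}

/-- The isometry constant `δ_r` of the linear map `A`: the smallest element of
`isometryBounds A r` (see `isLeast_isometryConstant`). -/
noncomputable def isometryConstant {n₁ n₂ m : ℕ}
    (A : Matrix (Fin n₁) (Fin n₂) ℝ →ₗ[ℝ] EuclideanSpace ℝ (Fin m)) (r : ℕ) : ℝ :=
  sInf (isometryBounds A r)

/-- A linear map between finite-dimensional normed spaces is bounded. -/
theorem exists_linearMap_bound {E F : Type*} [NormedAddCommGroup E] [NormedSpace ℝ E]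
    [FiniteDimensional ℝ E] [NormedAddCommGroup F] [NormedSpace ℝ F] (A : E →ₗ[ℝ] F) :
    ∃ C : ℝ, ∀ X : E, ‖A X‖ ≤ C * ‖X‖ :=
  ⟨‖LinearMap.toContinuousLinearMap A‖, (LinearMap.toContinuousLinearMap A).le_opNorm⟩

/-- For `1 ≤ r` and non-empty matrices, the isometry constant is attained. -/
theorem isLeast_isometryConstant {n₁ n₂ m : ℕ}
    (A : Matrix (Fin n₁) (Fin n₂) ℝ →ₗ[ℝ] EuclideanSpace ℝ (Fin m)) {r : ℕ}
    (hr : 1 ≤ r) (h₁ : 1 ≤ n₁) (h₂ : 1 ≤ n₂) :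
    IsLeast (isometryBounds A r) (isometryConstant A r) := by
  have hne : (isometryBounds A r).Nonempty := by
    obtain ⟨C, hC⟩ := exists_linearMap_bound A
    refine ⟨1 + C ^ 2, fun X _ => ?_⟩
    have h2 : ‖A X‖ ^ 2 ≤ (C * ‖X‖) ^ 2 := pow_le_pow_left₀ (norm_nonneg _) (hC X) 2
    constructor <;> nlinarith [sq_nonneg ‖X‖, sq_nonneg ‖A X‖, sq_nonneg (C * ‖X‖)]
  have hbdd : BddBelow (isometryBounds A r) := by
    refine ⟨0, fun δ hδ => ?_⟩
    let X : Matrix (Fin n₁) (Fin n₂) ℝ := Matrix.vecMulVec (fun _ => 1) (fun _ => 1)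
    have hX : X ≠ 0 := fun h => by
      have := congrFun (congrFun h ⟨0, h₁⟩) ⟨0, h₂⟩
      simp [X, Matrix.vecMulVec_apply] at this
    obtain ⟨ha, hb⟩ := hδ X ((Matrix.rank_vecMulVec_le _ _).trans hr)
    have : 0 < ‖X‖ ^ 2 := by have := norm_pos_iff.mpr hX; positivity
    nlinarith
  have hcl : IsClosed (isometryBounds A r) := by
    simp only [isometryBounds, Set.ofPred_forall, Set.ofPred_and]
    refine isClosed_iInter fun X => isClosed_iInter fun _ => ?_
    exact (isClosed_le (by fun_prop) (by fun_prop)).inter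
      (isClosed_le (by fun_prop) (by fun_prop))
  exact hcl.isLeast_csInf hne hbdd

/-! The supremum of the risk dominates its average over any prior carried by matrices of rank at
most `r`. Take independent `𝒩(0, τ²)` entries on `r` full rows or columns, whichever gives `n r`
entries, and zeros elsewhere. To bound the error at an entry `s`, reveal all the other entries: what
remains is a scalar Gaussian problem with posterior variance `σ²τ² / (σ² + τ² ‖A e_s‖²)`, `e_s`
being the matrix unit (`le_bayesRisk_coord`). Since `‖A e_s‖² ≤ 1 + δ_r`, summing over `s`
(`le_bayesRisk_restrictEntries`) and letting `τ → ∞` gives the bound. -/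

/-! ### Prediction from independent or uncorrelated Gaussian data -/

/-- A random variable independent of `U` is not predicted by any function of `U` with a mean
square error below its variance. -/
theorem ProbabilityTheory.IndepFun.variance_le_lintegral_sq_sub {Ω β : Type*} [MeasurableSpace Ω]
    [MeasurableSpace β] {P : Measure Ω} [IsProbabilityMeasure P] {U : Ω → β} {W : Ω → ℝ}
    (h : IndepFun U W P) (hU : AEMeasurable U P) (hW : MemLp W 2 P)
    {f : β → ℝ} (hf : Measurable f) :
    ENNReal.ofReal Var[W; P] ≤ ∫⁻ ω, ENNReal.ofReal ((f (U ω) - W ω) ^ 2) ∂P := by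
  have hWm := hW.aemeasurable
  have hmap := (indepFun_iff_map_prod_eq_prod_map_map hU hWm).1 h
  have hm : Measurable fun p : β × ℝ => ENNReal.ofReal ((f p.1 - p.2) ^ 2) := by fun_prop
  have hprob : IsProbabilityMeasure (P.map U) := Measure.isProbabilityMeasure_map hU
  have hprob' : IsProbabilityMeasure (P.map W) := Measure.isProbabilityMeasure_map hWm
  rw [← lintegral_map' (f := fun p : β × ℝ => ENNReal.ofReal ((f p.1 - p.2) ^ 2))
    (g := fun ω => (U ω, W ω)) hm.aemeasurable (hU.prodMk hWm), hmap,
    lintegral_prod _ hm.aemeasurable]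
  -- With `U = u` frozen by Tonelli, the prediction is a constant `c`, and `E (W - c)² ≥ Var W`.
  have key : ∀ c : ℝ, ENNReal.ofReal Var[W; P] ≤
      ∫⁻ w, ENNReal.ofReal ((c - w) ^ 2) ∂(P.map W) := fun c => by
    rw [lintegral_map' (by fun_prop) hWm]
    have hc : MemLp (fun ω => W ω - c) 2 P := hW.sub (memLp_const c)
    rw [← variance_sub_const hW.aestronglyMeasurable c]
    calc _ ≤ ENNReal.ofReal (∫ ω, (W ω - c) ^ 2 ∂P) :=
          ENNReal.ofReal_le_ofReal (variance_le_expectation_sq hc.aestronglyMeasurable)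
      _ = _ := by
        rw [ofReal_integral_eq_lintegral_ofReal hc.integrable_sq
          (Filter.Eventually.of_forall fun _ => sq_nonneg _)]
        simp only [sub_sq_comm]
  calc _ = ∫⁻ _, ENNReal.ofReal Var[W; P] ∂(P.map U) := by simp
    _ ≤ _ := lintegral_mono fun u => key _

/-- The covariance of two linear forms in independent centered Gaussians. -/
theorem covariance_dotProduct_pi_gaussianReal {κ : Type*} [Fintype κ] (v : κ → ℝ≥0)
    (a b : κ → ℝ) :
    cov[fun x => a ⬝ᵥ x, fun x => b ⬝ᵥ x; Measure.pi fun k => gaussianReal 0 (v k)] =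
      ∑ k, a k * b k * v k := by
  classical
  have hL (k : κ) : MemLp (fun x : κ → ℝ => x k) 2 (Measure.pi fun k => gaussianReal 0 (v k)) :=
    (memLp_id_gaussianReal 2).comp_measurePreserving (measurePreserving_eval _ k)
  have hind := iIndepFun_pi (μ := fun k => gaussianReal 0 (v k)) (X := fun _ => id)
    fun _ => aemeasurable_id
  have hcov (i j : κ) : cov[fun x : κ → ℝ => x i, fun x : κ → ℝ => x j;
      Measure.pi fun k => gaussianReal 0 (v k)] = if i = j then (v i : ℝ) else 0 := by
    split_ifs with hij
    · subst hij
      rw [covariance_self (measurable_pi_apply i).aemeasurable]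
      have h : HasLaw (fun x : κ → ℝ => x i) (gaussianReal 0 (v i))
        (Measure.pi fun k => gaussianReal 0 (v k)) := 
        (measurePreserving_eval (fun k => gaussianReal 0 (v k)) i).hasLaw
      rw [h.variance_eq, variance_id_gaussianReal]
    · exact (hind.indepFun hij).covariance_eq_zero (hL i) (hL j)
  simp only [dotProduct]
  rw [covariance_fun_sum_fun_sum (fun i => (hL i).const_mul _) fun i => (hL i).const_mul _]
  simp [covariance_const_mul_left, covariance_const_mul_right, hcov, mul_assoc, mul_left_comm]

/-- If the Gaussian linear form `w ⬝ᵥ x` is uncorrelated with the entries of `U *ᵥ x`, then no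
function of `U *ᵥ x` predicts it with a mean square error below its variance. -/
theorem le_lintegral_sq_sub_dotProduct {κ η : Type*} [Fintype κ] [Fintype η] (v : κ → ℝ≥0)
    (w : κ → ℝ) (U : Matrix η κ ℝ) (huw : ∀ i, ∑ k, U i k * w k * v k = 0)
    {f : (η → ℝ) → ℝ} (hf : Measurable f) :
    ENNReal.ofReal (∑ k, w k * w k * v k) ≤
      ∫⁻ x, ENNReal.ofReal ((f (U.mulVec x) - w ⬝ᵥ x) ^ 2)
        ∂(Measure.pi fun k => gaussianReal 0 (v k)) := by
  have hind := iIndepFun_pi (μ := fun k => gaussianReal 0 (v k)) (X := fun _ => id)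
    fun _ => aemeasurable_id
  have hg (k : κ) : HasGaussianLaw (fun x : κ → ℝ => x k)
      (Measure.pi fun k => gaussianReal 0 (v k)) :=
    (HasLaw.hasGaussianLaw (μ := gaussianReal 0 (v k)) 
      (measurePreserving_eval (fun k => gaussianReal 0 (v k)) k).hasLaw)
  have hG : HasGaussianLaw (fun x : κ → ℝ => x) (Measure.pi fun k => gaussianReal 0 (v k)) :=
    hind.hasGaussianLaw hg
  -- Joint Gaussianity turns zero covariance into independence.
  let T : (κ → ℝ) →ₗ[ℝ] (η → ℝ) × (Unit → ℝ) :=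
    U.mulVecLin.prod (LinearMap.pi fun _ => dotProductBilin ℝ ℝ w)
  have hT : HasGaussianLaw (fun x : κ → ℝ => (fun i => U i ⬝ᵥ x, fun _ : Unit => w ⬝ᵥ x))
      (Measure.pi fun k => gaussianReal 0 (v k)) := hG.map_fun (LinearMap.toContinuousLinearMap T)
  have hI := hT.indepFun_of_covariance_eval (X := fun i x => U i ⬝ᵥ x)
    (Y := fun _ x => w ⬝ᵥ x) fun i _ => by
      rw [covariance_dotProduct_pi_gaussianReal, huw]
  have hI' : IndepFun (fun x => U.mulVec x) (fun x => w ⬝ᵥ x)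
      (Measure.pi fun k => gaussianReal 0 (v k)) :=
    hI.comp (ψ := fun y : Unit → ℝ => y ()) measurable_id (by fun_prop)
  have hL : MemLp (fun x => w ⬝ᵥ x) 2 (Measure.pi fun k => gaussianReal 0 (v k)) :=
    (hT.snd.eval ()).memLp_two
  have := hI'.variance_le_lintegral_sq_sub
    (Continuous.matrix_mulVec continuous_const continuous_id).measurable.aemeasurable hL hf
  rwa [← covariance_self hL.aemeasurable, covariance_dotProduct_pi_gaussianReal] at this

/-! ### Bayes risk in the Gaussian linear model -/

/-- Bayes risk of one coordinate in the Gaussian linear model `y = B x + z` with the prior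
`x ∼ 𝒩(0, τ² I)` and noise `z ∼ 𝒩(0, σ² I)`. -/
theorem le_bayesRisk_coord {ι η : Type*} [Fintype ι] [Fintype η] (B : Matrix η ι ℝ) (τ : ℝ≥0)
    {σ : ℝ≥0} (hσ : 0 < σ) (j : ι) {g : (η → ℝ) → ℝ} (hg : Measurable g) :
    ENNReal.ofReal (σ ^ 2 * τ ^ 2 / (σ ^ 2 + τ ^ 2 * ∑ k, B k j ^ 2)) ≤
      ∫⁻ x, ENNReal.ofReal ((g (B.mulVec (fun i => x (.inl i)) + fun k => x (.inr k)) -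
        x (.inl j)) ^ 2) ∂(Measure.pi fun k : ι ⊕ η =>
          gaussianReal 0 (Sum.elim (fun _ => τ ^ 2) (fun _ => σ ^ 2) k)) := by
  classical
  set β := ∑ k, B k j ^ 2 with hβ
  have hβ0 : 0 ≤ β := Finset.sum_nonneg fun _ _ => sq_nonneg _
  have hσ' : (0 : ℝ) < σ := hσ
  set D : ℝ := σ ^ 2 + τ ^ 2 * β with hD
  have hD0 : 0 < D := by positivity
  -- `U` encodes the enlarged data: all `x i` with `i ≠ j`, and `B k j * x j + z k`. The form `w ⬝ᵥ
  -- x` is `x j` minus its best linear predictor from these data, hence uncorrelated with them.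
  let w : ι ⊕ η → ℝ := Sum.elim (Pi.single j (σ ^ 2 / D)) fun k => -(τ ^ 2 / D * B k j)
  let U : Matrix (ι ⊕ η) (ι ⊕ η) ℝ :=
    .fromBlocks (.diagonal fun i => if i = j then 0 else 1) 0 (.of fun k => Pi.single j (B k j)) 1
  have huw (i : ι ⊕ η) : ∑ k, U i k * w k *
      (Sum.elim (fun _ => τ ^ 2) (fun _ => σ ^ 2) k : ℝ≥0) = 0 := by
    rcases i with i | k
    · by_cases hij : i = j <;> simp [U, w, Matrix.diagonal_apply, Pi.single_apply, hij]
    · simp [U, w, Pi.single_apply, Matrix.one_apply]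
      ring
  -- Subtracting the same predictor from `g` makes `f (U x) - w ⬝ᵥ x` equal to `g y - x j`.
  let f : (ι ⊕ η → ℝ) → ℝ := fun u =>
    g (B.mulVec (fun i => u (.inl i)) + fun k => u (.inr k)) -
      τ ^ 2 / D * ∑ k, B k j * u (.inr k)
  have hf : Measurable f := by
    have h1 : Continuous fun u : ι ⊕ η → ℝ =>
        B.mulVec (fun i => u (.inl i)) + fun k => u (.inr k) := by
      have h0 : Continuous fun (u : ι ⊕ η → ℝ) (i : ι) => u (.inl i) := by fun_prop
      have h0' : Continuous fun (u : ι ⊕ η → ℝ) (k : η) => u (.inr k) := by fun_prop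
      exact (continuous_const.matrix_mulVec h0).add h0'
    have h2 : Continuous fun u : ι ⊕ η → ℝ => τ ^ 2 / D * ∑ k, B k j * u (.inr k) := by fun_prop
    exact (hg.comp h1.measurable).sub h2.measurable
  have hU1 (x : ι ⊕ η → ℝ) (i : ι) :
      U.mulVec x (.inl i) = if i = j then 0 else x (.inl i) := by
    simp [U, Matrix.mulVec, dotProduct, Matrix.diagonal_apply]
  have hU2 (x : ι ⊕ η → ℝ) (k : η) :
      U.mulVec x (.inr k) = B k j * x (.inl j) + x (.inr k) := by
    simp [U, Matrix.mulVec, dotProduct, Pi.single_apply, Matrix.one_apply]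
  -- The original observation is a function of the enlarged data.
  have hY (x : ι ⊕ η → ℝ) :
      (B.mulVec (fun i => U.mulVec x (.inl i)) + fun k => U.mulVec x (.inr k)) =
        B.mulVec (fun i => x (.inl i)) + fun k => x (.inr k) := by
    ext k
    simp only [hU1, hU2, Pi.add_apply]
    simp only [Matrix.mulVec, dotProduct]
    rw [← add_assoc, ← Finset.sum_erase_add _ _ (Finset.mem_univ j),
      ← Finset.sum_erase_add _ (fun i => B k i * x (.inl i)) (Finset.mem_univ j)]
    simp only [if_true, mul_zero, add_zero]
    congr 2
    refine Finset.sum_congr rfl fun i hi => ?_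
    rw [if_neg (Finset.ne_of_mem_erase hi)]
  have key := le_lintegral_sq_sub_dotProduct _ w U huw hf
  have hvar : ∑ k, w k * w k * (Sum.elim (fun _ => τ ^ 2) (fun _ => σ ^ 2) k : ℝ≥0) =
      σ ^ 2 * τ ^ 2 / D := by
    have h1 : ∑ k, τ ^ 2 / D * B k j * (τ ^ 2 / D * B k j) * (σ : ℝ) ^ 2 =
        (τ ^ 2 / D) ^ 2 * σ ^ 2 * β := by
      rw [hβ, Finset.mul_sum]
      exact Finset.sum_congr rfl fun _ _ => by ring
    simp only [Fintype.sum_sum_type, w, Sum.elim_inl, Sum.elim_inr, NNReal.coe_pow, neg_mul_neg, h1]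
    simp only [Pi.single_apply, ite_mul, mul_ite, mul_zero, zero_mul, ← ite_and, and_self,
      Finset.sum_ite_eq', Finset.mem_univ, if_true]
    field_simp
    rw [hD]
    ring
  rw [hvar] at key
  refine key.trans_eq (lintegral_congr fun x => ?_)
  congr 2
  simp only [f, hY]
  have h1 : ∑ k, B k j * U.mulVec x (.inr k) = β * x (.inl j) + ∑ k, B k j * x (.inr k) := by
    simp only [hU2, mul_add, Finset.sum_add_distrib, hβ, Finset.sum_mul]
    congr 1
    exact Finset.sum_congr rfl fun _ _ => by ring
  have h2 : w ⬝ᵥ x = σ ^ 2 / D * x (.inl j) - τ ^ 2 / D * ∑ k, B k j * x (.inr k) := by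
    simp [w, dotProduct, Pi.single_apply, Finset.mul_sum, sub_eq_add_neg, mul_assoc]
  rw [h1, h2]
  have h3 : (σ : ℝ) ^ 2 / D = 1 - τ ^ 2 / D * β := by
    field_simp
    rw [hD]
    ring
  rw [h3]
  ring

/-! ### Matrices supported on few rows or columns -/

/-- For the Frobenius norm, the squared norm is the sum of the squared entries. -/
theorem Matrix.frobenius_norm_sq_eq_sum {m n : Type*} [Fintype m] [Fintype n]
    (X : Matrix m n ℝ) : ‖X‖ ^ 2 = ∑ p : m × n, X p.1 p.2 ^ 2 := by
  have h : 0 ≤ ∑ i, ∑ j, ‖X i j‖ ^ (2 : ℝ) := by positivity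
  rw [Matrix.frobenius_norm_def, ← Real.sqrt_eq_rpow, Real.sq_sqrt h, Fintype.sum_prod_type]
  simp

/-- Setting the entries of a matrix outside `S` to zero. -/
def Matrix.restrictEntries {n₁ n₂ : ℕ} (S : Finset (Fin n₁ × Fin n₂)) :
    (Fin n₁ × Fin n₂ → ℝ) →ₗ[ℝ] Matrix (Fin n₁) (Fin n₂) ℝ where
  toFun x := .of fun i j => if (i, j) ∈ S then x (i, j) else 0
  map_add' x y := by
    ext i j
    by_cases h : (i, j) ∈ S <;> simp [h]
  map_smul' c x := by
    ext i j
    by_cases h : (i, j) ∈ S <;> simp [h]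

theorem Matrix.restrictEntries_apply {n₁ n₂ : ℕ} (S : Finset (Fin n₁ × Fin n₂))
    (x : Fin n₁ × Fin n₂ → ℝ) (i : Fin n₁) (j : Fin n₂) :
    Matrix.restrictEntries S x i j = if (i, j) ∈ S then x (i, j) else 0 := rfl

theorem Fin.card_subtype_val_lt {n r : ℕ} (h : r ≤ n) :
    Fintype.card {i : Fin n // (i : ℕ) < r} = r := by
  rw [Fintype.card_subtype, Fin.card_filter_val_lt, min_eq_right h]

/-- A pattern of `max n₁ n₂ * r` entries such that matrices supported on it have rank at
most `r`. -/
theorem exists_rank_restrictEntries_le {n₁ n₂ r : ℕ} (hr₁ : r ≤ n₁) (hr₂ : r ≤ n₂) :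
    ∃ S : Finset (Fin n₁ × Fin n₂), S.card = max n₁ n₂ * r ∧
      ∀ x, (Matrix.restrictEntries S x).rank ≤ r := by
  classical
  rcases le_total n₁ n₂ with h | h
  · refine ⟨Finset.univ.filter (fun i : Fin n₁ => (i : ℕ) < r) ×ˢ Finset.univ, ?_, fun x => ?_⟩
    · rw [Finset.card_product, ← Fintype.card_subtype, Fin.card_subtype_val_lt hr₁, max_eq_right h]
      simp [mul_comm]
    -- Vanishing outside `r` rows means factoring through a diagonal projection of rank `r`.
    · have hM : ∀ M : Matrix (Fin n₁) (Fin n₂) ℝ, (∀ (i : Fin n₁) (j : Fin n₂), ¬ (i : ℕ) < r → M i j = 0) →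
          M = Matrix.diagonal (fun i : Fin n₁ => if (i : ℕ) < r then (1 : ℝ) else 0) * M := by
        intro M hM
        ext i j
        rw [Matrix.diagonal_mul]
        split_ifs with hi <;> simp [hM i j, hi]
      rw [hM (Matrix.restrictEntries _ x) fun i j hi => by simp [Matrix.restrictEntries_apply, hi]]
      refine (Matrix.rank_mul_le_left _ _).trans ?_
      rw [Matrix.rank_diagonal]
      simp [Fin.card_subtype_val_lt hr₁]
  · refine ⟨Finset.univ ×ˢ Finset.univ.filter (fun i : Fin n₂ => (i : ℕ) < r), ?_, fun x => ?_⟩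
    · rw [Finset.card_product, ← Fintype.card_subtype, Fin.card_subtype_val_lt hr₂, max_eq_left h]
      simp
    · have hM : ∀ M : Matrix (Fin n₁) (Fin n₂) ℝ, (∀ (i : Fin n₁) (j : Fin n₂), ¬ (j : ℕ) < r → M i j = 0) →
          M = M * Matrix.diagonal (fun i : Fin n₂ => if (i : ℕ) < r then (1 : ℝ) else 0) := by
        intro M hM
        ext i j
        rw [Matrix.mul_diagonal]
        split_ifs with hi <;> simp [hM i j, hi]
      rw [hM (Matrix.restrictEntries _ x) fun i j hi => by simp [Matrix.restrictEntries_apply, hi]]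
      refine (Matrix.rank_mul_le_right _ _).trans ?_
      rw [Matrix.rank_diagonal]
      simp [Fin.card_subtype_val_lt hr₂]

/-! ### From Bayes risk to minimax risk -/

/-- Lower bound for the Bayes risk of an estimator under the Gaussian prior on the entries in
`S`. -/
theorem le_bayesRisk_restrictEntries {n₁ n₂ m : ℕ}
    (A : Matrix (Fin n₁) (Fin n₂) ℝ →ₗ[ℝ] EuclideanSpace ℝ (Fin m))
    (S : Finset (Fin n₁ × Fin n₂)) {σ : ℝ≥0} (hσ : 0 < σ) (τ : ℝ≥0) {c : ℝ}
    (hc : ∀ s ∈ S, ‖A (Matrix.restrictEntries S (Pi.single s 1))‖ ^ 2 ≤ c)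
    {Mhat : EuclideanSpace ℝ (Fin m) → Matrix (Fin n₁) (Fin n₂) ℝ}
    (hMhat : ∀ i j, Measurable fun y => Mhat y i j) :
    ENNReal.ofReal (S.card * (σ ^ 2 * τ ^ 2 / (σ ^ 2 + τ ^ 2 * c))) ≤
      ∫⁻ x, ∫⁻ ζ, ENNReal.ofReal (‖Mhat (A (Matrix.restrictEntries S x) + WithLp.toLp 2 ζ) -
          Matrix.restrictEntries S x‖ ^ 2)
        ∂(Measure.pi fun _ : Fin m => gaussianReal 0 (σ ^ 2))
        ∂(Measure.pi fun _ : Fin n₁ × Fin n₂ => gaussianReal 0 (τ ^ 2)) := by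
  set ν := Measure.pi fun _ : Fin m => gaussianReal 0 (σ ^ 2) with hν
  set π := Measure.pi fun _ : Fin n₁ × Fin n₂ => gaussianReal 0 (τ ^ 2) with hπ
  let B : Matrix (Fin m) (Fin n₁ × Fin n₂) ℝ := LinearMap.toMatrix'
    ((WithLp.linearEquiv 2 ℝ (Fin m → ℝ)).toLinearMap ∘ₗ A ∘ₗ Matrix.restrictEntries S)
  have hB (x : Fin n₁ × Fin n₂ → ℝ) :
      WithLp.toLp 2 (B.mulVec x) = A (Matrix.restrictEntries S x) := by
    simp only [B, LinearMap.toMatrix'_mulVec]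
    rfl
  have hBs (s) (hs : s ∈ S) : ∑ k, B k s ^ 2 ≤ c := by
    refine le_trans (le_of_eq ?_) (hc s hs)
    rw [← hB, EuclideanSpace.real_norm_sq_eq]
    simp
  let g (s : Fin n₁ × Fin n₂) (y : Fin m → ℝ) : ℝ := Mhat (WithLp.toLp 2 y) s.1 s.2
  have hg (s) : Measurable (g s) := (hMhat s.1 s.2).comp (WithLp.measurable_toLp 2 _)
  have hBm : Measurable fun p : (Fin n₁ × Fin n₂ → ℝ) × (Fin m → ℝ) => B.mulVec p.1 + p.2 :=
    ((Continuous.matrix_mulVec continuous_const continuous_fst).add continuous_snd).measurable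
  have hq (s : Fin n₁ × Fin n₂) : Measurable fun p : (Fin n₁ × Fin n₂ → ℝ) × (Fin m → ℝ) =>
      ENNReal.ofReal ((g s (B.mulVec p.1 + p.2) - p.1 s) ^ 2) :=
    ENNReal.measurable_ofReal.comp ((((hg s).comp hBm).sub (by fun_prop)).pow_const 2)
  have hcoord (s) (hs : s ∈ S) :
      ENNReal.ofReal (σ ^ 2 * τ ^ 2 / (σ ^ 2 + τ ^ 2 * c)) ≤
        ∫⁻ p, ENNReal.ofReal ((g s (B.mulVec p.1 + p.2) - p.1 s) ^ 2) ∂(π.prod ν) := by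
    have hσ' : (0 : ℝ) < σ := hσ
    have h0 : 0 ≤ ∑ k, B k s ^ 2 := Finset.sum_nonneg fun _ _ => sq_nonneg _
    have hle : (σ : ℝ) ^ 2 * τ ^ 2 / (σ ^ 2 + τ ^ 2 * c) ≤
        σ ^ 2 * τ ^ 2 / (σ ^ 2 + τ ^ 2 * ∑ k, B k s ^ 2) := by
      gcongr
      exact hBs s hs
    refine (ENNReal.ofReal_le_ofReal hle).trans ((le_bayesRisk_coord B τ hσ s (hg s)).trans_eq ?_)
    have hmp := measurePreserving_sumPiEquivProdPi
      fun k : (Fin n₁ × Fin n₂) ⊕ Fin m =>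
        gaussianReal 0 (Sum.elim (fun _ => τ ^ 2) (fun _ => σ ^ 2) k)
    exact hmp.lintegral_comp (hq s)
  calc ENNReal.ofReal (S.card * (σ ^ 2 * τ ^ 2 / (σ ^ 2 + τ ^ 2 * c)))
      = ∑ _s ∈ S, ENNReal.ofReal (σ ^ 2 * τ ^ 2 / (σ ^ 2 + τ ^ 2 * c)) := by
        rw [Finset.sum_const, nsmul_eq_mul, ENNReal.ofReal_mul (Nat.cast_nonneg _),
          ENNReal.ofReal_natCast]
    _ ≤ ∑ s ∈ S, ∫⁻ p, ENNReal.ofReal ((g s (B.mulVec p.1 + p.2) - p.1 s) ^ 2) ∂(π.prod ν) :=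
        Finset.sum_le_sum hcoord
    _ = ∫⁻ p, ∑ s ∈ S, ENNReal.ofReal ((g s (B.mulVec p.1 + p.2) - p.1 s) ^ 2) ∂(π.prod ν) :=
        (lintegral_finsetSum _ fun s _ => hq s).symm
    _ = ∫⁻ x, ∫⁻ ζ, ∑ s ∈ S, ENNReal.ofReal ((g s (B.mulVec x + ζ) - x s) ^ 2) ∂ν ∂π :=
        lintegral_prod _ (Finset.measurable_fun_sum S fun s _ => hq s).aemeasurable
    -- The errors at entries outside `S` are discarded.
    _ ≤ _ := by
        refine lintegral_mono fun x => lintegral_mono fun ζ => ?_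
        rw [← ENNReal.ofReal_sum_of_nonneg fun _ _ => sq_nonneg _,
          Matrix.frobenius_norm_sq_eq_sum]
        refine ENNReal.ofReal_le_ofReal ?_
        refine le_trans (le_of_eq ?_) (Finset.sum_le_sum_of_subset_of_nonneg
          (Finset.subset_univ S) fun _ _ _ => sq_nonneg _)
        refine Finset.sum_congr rfl fun s hs => ?_
        rw [Matrix.sub_apply, Matrix.restrictEntries_apply, if_pos hs, ← hB]
        rfl

theorem mainTheorem5 {n₁ n₂ m r : ℕ} (hr : 1 ≤ r) (hr₁ : r ≤ n₁) (hr₂ : r ≤ n₂)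
    (A : Matrix (Fin n₁) (Fin n₂) ℝ →ₗ[ℝ] EuclideanSpace ℝ (Fin m))
    {Ω : Type*} [MeasurableSpace Ω] (P : Measure Ω) [IsProbabilityMeasure P]
    (σ : ℝ≥0) (z : Fin m → Ω → ℝ)
    (hz : ∀ i, HasLaw (z i) (gaussianReal 0 (σ ^ 2)) P) (hindep : iIndepFun z P)
    (Mhat : EuclideanSpace ℝ (Fin m) → Matrix (Fin n₁) (Fin n₂) ℝ)
    (hMhat : ∀ i j, Measurable fun y => Mhat y i j) :
    ENNReal.ofReal (1 / (1 + isometryConstant A r) * ((max n₁ n₂ : ℕ) * r * (σ : ℝ) ^ 2)) ≤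
      ⨆ (M : Matrix (Fin n₁) (Fin n₂) ℝ) (_ : M.rank ≤ r),
        ∫⁻ ω, ENNReal.ofReal (‖Mhat (A M + WithLp.toLp 2 fun i => z i ω) - M‖ ^ 2) ∂P := by
  rcases eq_zero_or_pos σ with rfl | hσ
  · simp
  obtain ⟨S, hcard, hrank⟩ := exists_rank_restrictEntries_le hr₁ hr₂
  have hδ := (isLeast_isometryConstant A hr (hr.trans hr₁) (hr.trans hr₂)).1
  set δ := isometryConstant A r
  have hnorm (s) (hs : s ∈ S) : ‖Matrix.restrictEntries S (Pi.single s (1 : ℝ))‖ ^ 2 = 1 := by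
    rw [Matrix.frobenius_norm_sq_eq_sum, Finset.sum_eq_single s]
    · simp [Matrix.restrictEntries_apply, hs]
    · intro p _ hp
      simp [Matrix.restrictEntries_apply, hp]
    · simp
  -- On a unit-norm test matrix the two isometry bounds give `1 - δ ≤ 1 + δ`, so `δ ≥ 0`.
  have hc : 0 < 1 + δ := by
    obtain ⟨s, hs⟩ : S.Nonempty := by
      rw [← Finset.card_pos, hcard]
      have := hr.trans hr₁
      positivity
    have h := hδ _ (hrank (Pi.single s 1))
    rw [hnorm s hs] at h
    linarith
  have hA (s) (hs : s ∈ S) : ‖A (Matrix.restrictEntries S (Pi.single s 1))‖ ^ 2 ≤ 1 + δ := by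
    have h := (hδ _ (hrank (Pi.single s 1))).2
    rwa [hnorm s hs, mul_one] at h
  have hlaw : HasLaw (fun ω i => z i ω) (Measure.pi fun _ : Fin m => gaussianReal 0 (σ ^ 2)) P :=
    hindep.hasLaw_pi hz
  have hrisk (M : Matrix (Fin n₁) (Fin n₂) ℝ) :
      ∫⁻ ω, ENNReal.ofReal (‖Mhat (A M + WithLp.toLp 2 fun i => z i ω) - M‖ ^ 2) ∂P =
        ∫⁻ ζ, ENNReal.ofReal (‖Mhat (A M + WithLp.toLp 2 ζ) - M‖ ^ 2)
          ∂(Measure.pi fun _ : Fin m => gaussianReal 0 (σ ^ 2)) := by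
    refine hlaw.lintegral_comp (f := fun ζ =>
      ENNReal.ofReal (‖Mhat (A M + WithLp.toLp 2 ζ) - M‖ ^ 2)) (Measurable.aemeasurable ?_)
    simp only [Matrix.frobenius_norm_sq_eq_sum, Matrix.sub_apply]
    refine ENNReal.measurable_ofReal.comp (Finset.measurable_fun_sum _ fun p _ => ?_)
    exact (((hMhat p.1 p.2).comp
      ((WithLp.measurable_toLp 2 _).const_add (A M))).sub_const _).pow_const 2
  simp only [hrisk]
  -- Prior variance `τ² = N + 1`, with numerator and denominator divided by `τ²` so that the limit
  -- `N → ∞` is visible.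
  have hbayes (N : ℕ) :
      ENNReal.ofReal ((max n₁ n₂ : ℕ) * r * (σ ^ 2 / (σ ^ 2 * (1 / ((N : ℝ) + 1)) + (1 + δ)))) ≤
        ⨆ (M : Matrix (Fin n₁) (Fin n₂) ℝ) (_ : M.rank ≤ r),
          ∫⁻ ζ, ENNReal.ofReal (‖Mhat (A M + WithLp.toLp 2 ζ) - M‖ ^ 2)
            ∂(Measure.pi fun _ : Fin m => gaussianReal 0 (σ ^ 2)) := by
    have h := le_bayesRisk_restrictEntries A S hσ (NNReal.sqrt (N + 1)) hA hMhat
    have hτ : ((NNReal.sqrt (N + 1) : ℝ≥0) : ℝ) ^ 2 = N + 1 := by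
      rw [← NNReal.coe_pow, NNReal.sq_sqrt]
      push_cast
      rfl
    have hσ' : (0 : ℝ) < σ := hσ
    rw [hτ, hcard, show (σ : ℝ) ^ 2 * (N + 1) / (σ ^ 2 + (N + 1) * (1 + δ)) =
      σ ^ 2 / (σ ^ 2 * (1 / ((N : ℝ) + 1)) + (1 + δ)) by field_simp] at h
    push_cast at h ⊢
    refine h.trans ((lintegral_mono fun x => le_iSup₂ (f := fun (M : Matrix (Fin n₁) (Fin n₂) ℝ)
      (_ : M.rank ≤ r) => ∫⁻ ζ, ENNReal.ofReal (‖Mhat (A M + WithLp.toLp 2 ζ) - M‖ ^ 2)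
        ∂(Measure.pi fun _ : Fin m => gaussianReal 0 (σ ^ 2))) _ (hrank x)).trans ?_)
    simp only [lintegral_const, measure_univ, mul_one, le_refl]
  refine le_of_tendsto' (x := Filter.atTop) (ENNReal.tendsto_ofReal ?_) hbayes
  rw [show 1 / (1 + δ) * ((max n₁ n₂ : ℕ) * r * (σ : ℝ) ^ 2) =
    (max n₁ n₂ : ℕ) * r * (σ ^ 2 / (σ ^ 2 * 0 + (1 + δ))) by field_simp; ring]
  refine Filter.Tendsto.const_mul _ (Filter.Tendsto.div tendsto_const_nhds ?_ (by simp [hc.ne']))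
  exact (tendsto_one_div_add_atTop_nhds_zero_nat.const_mul _).add_const _
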